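/- Let $A$ be a commutative ring with identity in which $2$ is invertible, and let $(Q,q)$ be a quadratic space over $A$: a finitely generated projective $A$-module $Q$ with a non-singular quadratic form $q$, i.e. the symmetric bilinear form $\langle z,z'\rangle=q(z+z')-q(z)-q(z')$ induces an isomorphism $Q\to Q^*=\operatorname{Hom}_A(Q,A)$. For $m\ge 0$ let $P=A^m$, and let $Q\perp H(A)^m$ be the module $Q\oplus P\oplus P^*$ with the quadratic form $(z,x,f)\mapsto q(z)+f(x)$; let $O_A(Q\perp H(A)^m)$ be its orthogonal group. For $\alpha\in\operatorname{Hom}_A(Q,P)$ and $\beta\in\operatorname{Hom}_A(Q,P^*)$ let $\alpha^*:P^*\to Q$ and $\beta^*:P\to Q$ be defined by $\langle\alpha^*f,z\rangle=f(\alpha z)$ and $\langle\beta^*x,z\rangle=\beta(z)(x)$, and put $$E_\alpha(z,x,f)=\bigl(z-\alpha^*f,\;x+\alpha z-\tfrac12\alpha\alpha^*f,\;f\bigr),\qquad E^*_\beta(z,x,f)=\bigl(z-\beta^*x,\;x,\;f+\beta z-\tfrac12\beta\beta^*x\bigr).$$ These are elements of $O_A(Q\perp H(A)^m)$. Let $EO_A(Q\perp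 H(A)^m)$ be the subgroup of $O_A(Q\perp H(A)^m)$ generated by all $E_\alpha$ and $E^*_\beta$. Let $d=\dim\operatorname{Max}(A)$ be the Krull dimension of the space of maximal ideals of $A$ with the Zariski topology (the supremum of the lengths of chains of irreducible closed subsets). If $m\ge d+2$, then $EO_A(Q\perp H(A)^m)$ is a normal subgroup of $O_A(Q\perp H(A)^m)$. -/

import Mathlib

namespace RoyOrthogonal

universe u v w

/-- A quadratic form `q` is non-singular when the symmetric bilinear form
`⟨x, y⟩ = q (x + y) - q x - q y` induces a bijection from `Q` onto its dual. -/
def Nonsingular {A : Type u} [CommRing A] {Q : Type v} [AddCommGroup Q] [Module A Q]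
    (q : QuadraticForm A Q) : Prop :=
  Function.Bijective q.polarBilin

/-- The orthogonal group of a quadratic form: the linear automorphisms that preserve it. -/
def orthogonalGroup {A : Type u} [CommRing A] {M : Type v} [AddCommGroup M] [Module A M]
    (q : QuadraticForm A M) : Subgroup (M ≃ₗ[A] M) where
  carrier := {g | ∀ x, q (g x) = q x}
  mul_mem' := by
    intro g h hg hh x
    rw [LinearEquiv.mul_apply, hg, hh]
  one_mem' := by
    intro x
    rfl
  inv_mem' := by
    intro g hg x
    have h := hg (g⁻¹ x)
    rw [← h, ← LinearEquiv.mul_apply, mul_inv_cancel]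
    rfl

section Construction

variable {A : Type u} [CommRing A] {Q : Type v} [AddCommGroup Q] [Module A Q]
  {P : Type w} [AddCommGroup P] [Module A P]

/-- The quadratic space `Q ⊥ H(P)`: the module `Q ⊕ (P* ⊕ P)` with the form
`(z, (f, x)) ↦ q z + f x`. -/
def hyperbolicSum (q : QuadraticForm A Q) (P : Type w) [AddCommGroup P] [Module A P] :
    QuadraticForm A (Q × (Module.Dual A P × P)) :=
  q.prod (QuadraticForm.dualProd A P)

/-- The isomorphism `Q ≃ Q*`, `z ↦ ⟨z, ·⟩`, of a non-singular quadratic form. -/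
noncomputable def dualEquiv (q : QuadraticForm A Q) (hq : Nonsingular q) :
    Q ≃ₗ[A] Module.Dual A Q :=
  LinearEquiv.ofBijective q.polarBilin hq

/-- The adjoint `α* : P* → Q` of `α : Q → P`, determined by `⟨α* f, z⟩ = f (α z)`. -/
noncomputable def adjoint (q : QuadraticForm A Q) (hq : Nonsingular q) (α : Q →ₗ[A] P) :
    Module.Dual A P →ₗ[A] Q :=
  (dualEquiv q hq).symm.toLinearMap ∘ₗ α.dualMap

/-- The adjoint `β* : P → Q` of `β : Q → P*`, determined by `⟨β* x, z⟩ = β z x`. -/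
noncomputable def adjointDual (q : QuadraticForm A Q) (hq : Nonsingular q)
    (β : Q →ₗ[A] Module.Dual A P) : P →ₗ[A] Q :=
  (dualEquiv q hq).symm.toLinearMap ∘ₗ β.flip

theorem polar_dualEquiv_symm (q : QuadraticForm A Q) (hq : Nonsingular q)
    (g : Module.Dual A Q) (z : Q) :
    QuadraticMap.polar q ((dualEquiv q hq).symm g) z = g z :=
  LinearMap.congr_fun ((dualEquiv q hq).apply_symm_apply g) z

theorem polar_adjoint (q : QuadraticForm A Q) (hq : Nonsingular q) (α : Q →ₗ[A] P)
    (f : Module.Dual A P) (z : Q) :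
    QuadraticMap.polar q (adjoint q hq α f) z = f (α z) :=
  polar_dualEquiv_symm q hq (α.dualMap f) z

theorem polar_adjointDual (q : QuadraticForm A Q) (hq : Nonsingular q)
    (β : Q →ₗ[A] Module.Dual A P) (x : P) (z : Q) :
    QuadraticMap.polar q (adjointDual q hq β x) z = β z x :=
  polar_dualEquiv_symm q hq (β.flip x) z

theorem adjoint_neg (q : QuadraticForm A Q) (hq : Nonsingular q) (α : Q →ₗ[A] P)
    (f : Module.Dual A P) : adjoint q hq (-α) f = -adjoint q hq α f := by
  have h : (-α).dualMap f = -(α.dualMap f) := by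
    ext z
    simp
  simp only [adjoint, LinearMap.comp_apply, h, map_neg]

theorem adjointDual_neg (q : QuadraticForm A Q) (hq : Nonsingular q)
    (β : Q →ₗ[A] Module.Dual A P) (x : P) :
    adjointDual q hq (-β) x = -adjointDual q hq β x := by
  have h : (-β).flip x = -(β.flip x) := by
    ext z
    simp
  simp only [adjointDual, LinearMap.comp_apply, h, map_neg]

variable [Invertible (2 : A)]

theorem apply_sub_eq (q : QuadraticForm A Q) (z y : Q) :
    q (z - y) = q z - QuadraticMap.polar q y z + ⅟(2 : A) * QuadraticMap.polar q y y := by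
  rw [sub_eq_add_neg, QuadraticMap.map_add q z (-y), QuadraticMap.map_neg, QuadraticMap.polar_neg_right,
    QuadraticMap.polar_comm q z y, QuadraticMap.polar_self, nsmul_eq_mul, Nat.cast_ofNat,
    invOf_mul_cancel_left]
  ring

/-- The map `I - α* + α - (1/2) α α*`, that is
`(z, x, f) ↦ (z - α* f, x + α z - (1/2) α (α* f), f)`. -/
noncomputable def elemMap (q : QuadraticForm A Q) (hq : Nonsingular q) (α : Q →ₗ[A] P) :
    Q × (Module.Dual A P × P) →ₗ[A] Q × (Module.Dual A P × P) where
  toFun v :=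
    (v.1 - adjoint q hq α v.2.1,
      (v.2.1, v.2.2 + α v.1 - ⅟(2 : A) • α (adjoint q hq α v.2.1)))
  map_add' v v' := by
    ext1
    · simp only [Prod.fst_add, Prod.snd_add, map_add]
      abel
    · ext1
      · rfl
      · simp only [Prod.fst_add, Prod.snd_add, map_add, smul_add]
        abel
  map_smul' c v := by
    ext1
    · simp only [Prod.smul_fst, Prod.smul_snd, map_smul, smul_sub, RingHom.id_apply]
    · ext1
      · rfl
      · simp only [Prod.smul_fst, Prod.smul_snd, map_smul, smul_sub, smul_add, RingHom.id_apply,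
          smul_comm c (⅟(2 : A))]

/-- The map `I - β* + β - (1/2) β β*`, that is
`(z, x, f) ↦ (z - β* x, x, f + β z - (1/2) β (β* x))`. -/
noncomputable def elemDualMap (q : QuadraticForm A Q) (hq : Nonsingular q)
    (β : Q →ₗ[A] Module.Dual A P) :
    Q × (Module.Dual A P × P) →ₗ[A] Q × (Module.Dual A P × P) where
  toFun v :=
    (v.1 - adjointDual q hq β v.2.2,
      (v.2.1 + β v.1 - ⅟(2 : A) • β (adjointDual q hq β v.2.2), v.2.2))
  map_add' v v' := by
    ext1
    · simp only [Prod.fst_add, Prod.snd_add, map_add]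
      abel
    · ext1
      · simp only [Prod.fst_add, Prod.snd_add, map_add, smul_add]
        abel
      · rfl
  map_smul' c v := by
    ext1
    · simp only [Prod.smul_fst, Prod.smul_snd, map_smul, smul_sub, RingHom.id_apply]
    · ext1
      · simp only [Prod.smul_fst, Prod.smul_snd, map_smul, smul_sub, smul_add, RingHom.id_apply,
          smul_comm c (⅟(2 : A))]
      · rfl

theorem half_add_half {M : Type w} [AddCommGroup M] [Module A M] (x : M) :
    ⅟(2 : A) • x + ⅟(2 : A) • x = x := by
  rw [← two_smul A (⅟(2 : A) • x), smul_smul, mul_invOf_self, one_smul]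

theorem elemMap_elemMap_neg (q : QuadraticForm A Q) (hq : Nonsingular q) (α : Q →ₗ[A] P)
    (v : Q × (Module.Dual A P × P)) : elemMap q hq α (elemMap q hq (-α) v) = v := by
  have h := half_add_half (A := A) (α (adjoint q hq α v.2.1))
  ext1
  · simp [elemMap, adjoint_neg]
  · ext1
    · simp [elemMap]
    · simp only [elemMap, LinearMap.coe_mk, AddHom.coe_mk, adjoint_neg, LinearMap.neg_apply,
        map_neg, map_sub, neg_neg]
      nth_rewrite 2 [← h]
      abel

theorem elemDualMap_elemDualMap_neg (q : QuadraticForm A Q) (hq : Nonsingular q)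
    (β : Q →ₗ[A] Module.Dual A P) (v : Q × (Module.Dual A P × P)) :
    elemDualMap q hq β (elemDualMap q hq (-β) v) = v := by
  have h := half_add_half (A := A) (β (adjointDual q hq β v.2.2))
  ext1
  · simp [elemDualMap, adjointDual_neg]
  · ext1
    · simp only [elemDualMap, LinearMap.coe_mk, AddHom.coe_mk, adjointDual_neg,
        LinearMap.neg_apply, map_neg, map_sub, neg_neg]
      nth_rewrite 2 [← h]
      abel
    · simp [elemDualMap]

theorem hyperbolicSum_elemMap (q : QuadraticForm A Q) (hq : Nonsingular q) (α : Q →ₗ[A] P)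
    (v : Q × (Module.Dual A P × P)) :
    hyperbolicSum q P (elemMap q hq α v) = hyperbolicSum q P v := by
  simp only [hyperbolicSum, QuadraticMap.prod_apply, QuadraticForm.dualProd_apply, elemMap,
    LinearMap.coe_mk, AddHom.coe_mk, apply_sub_eq, polar_adjoint, map_add, map_sub, map_smul,
    smul_eq_mul]
  ring

theorem hyperbolicSum_elemDualMap (q : QuadraticForm A Q) (hq : Nonsingular q)
    (β : Q →ₗ[A] Module.Dual A P) (v : Q × (Module.Dual A P × P)) :
    hyperbolicSum q P (elemDualMap q hq β v) = hyperbolicSum q P v := by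
  simp only [hyperbolicSum, QuadraticMap.prod_apply, QuadraticForm.dualProd_apply, elemDualMap,
    LinearMap.coe_mk, AddHom.coe_mk, apply_sub_eq, polar_adjointDual, LinearMap.add_apply,
    LinearMap.sub_apply, LinearMap.smul_apply, smul_eq_mul]
  ring

/-- The elementary orthogonal transformation `E_α` of `Q ⊥ H(P)`, for `α ∈ Hom(Q, P)`. -/
noncomputable def elem (q : QuadraticForm A Q) (hq : Nonsingular q) (α : Q →ₗ[A] P) :
    orthogonalGroup (hyperbolicSum q P) :=
  ⟨LinearEquiv.ofLinearMap (elemMap q hq α) (elemMap q hq (-α))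
      (LinearMap.ext (elemMap_elemMap_neg q hq α))
      (LinearMap.ext fun v => by
        have h := elemMap_elemMap_neg q hq (-α) v
        rwa [neg_neg] at h),
    hyperbolicSum_elemMap q hq α⟩

/-- The elementary orthogonal transformation `E*_β` of `Q ⊥ H(P)`, for `β ∈ Hom(Q, P*)`. -/
noncomputable def elemDual (q : QuadraticForm A Q) (hq : Nonsingular q)
    (β : Q →ₗ[A] Module.Dual A P) : orthogonalGroup (hyperbolicSum q P) :=
  ⟨LinearEquiv.ofLinearMap (elemDualMap q hq β) (elemDualMap q hq (-β))
      (LinearMap.ext (elemDualMap_elemDualMap_neg q hq β))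
      (LinearMap.ext fun v => by
        have h := elemDualMap_elemDualMap_neg q hq (-β) v
        have e : -(-β) = β := by
          ext z x
          simp
        rwa [e] at h),
    hyperbolicSum_elemDualMap q hq β⟩

/-- Roy's elementary orthogonal group `EO_A(Q ⊥ H(P))`: the subgroup of `O_A(Q ⊥ H(P))`
generated by all `E_α` and `E*_β`. -/
noncomputable def elementaryOrthogonalGroup (q : QuadraticForm A Q) (hq : Nonsingular q)
    (P : Type w) [AddCommGroup P] [Module A P] :
    Subgroup (orthogonalGroup (hyperbolicSum q P)) :=
  Subgroup.closure
    (Set.range (fun α : Q →ₗ[A] P => elem q hq α) ∪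
      Set.range (fun β : Q →ₗ[A] Module.Dual A P => elemDual q hq β))

end Construction

end RoyOrthogonal

/-!
The Siegel transformation of an isotropic vector `u` and of `v ∈ u^⊥` is
`x ↦ x + ⟨u, x⟩ v - ⟨v, x⟩ u - Φ(v) ⟨u, x⟩ u`. It is additive in `v`, conjugation by an
orthogonal `g` replaces `(u, v)` by `(g u, g v)`, and if `v` is isotropic too, exchanging `u` and
`v` inverts it. Up to commutators, Roy's generators are products of the Siegel transformations of
`h_k` and `w`, with `h_k` a basis vector of `P` or `P*` and `w ∈ Q` (`exists_eichler`). Normality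
therefore follows once the elementary group `H` contains the Siegel transformations of `g h_k`
and `g w` for every orthogonal `g`. The dimension hypothesis is used only through `2 ≤ m`, which
holds because the maximal spectrum of a nonzero ring is not empty.

Let `T` be the ideal generated by the values of the bilinear form on `Q`. Since `Q` is projective
and the form is non-singular, `Q = T Q` (`range_inl_le_smul`). So it suffices that for `u = g h_k`
all Siegel transformations of `u` and `t v`, with `t ∈ T` and `v ∈ u^⊥`, lie in `H`. The vectors
`v` with this property form the submodule `siegelSubmodule H Q u`. Let `s = ⟨u, h_k⟩` for some
vector `h_k` of the frame. Using a second hyperbolic plane, `u^⊥` contains vectors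
`v = s h_l + c h_k`, and images of such vectors under Siegel transformations in `H`. They are
isotropic, all Siegel transformations of `v` and `T v^⊥` lie in `H` (`isFull`), and by exchanging
`u` and `v` they belong to the Siegel submodule of `u`. They generate enough of `u^⊥` to give
`s² u^⊥ ⊆ siegelSubmodule H Q u` (`smul_smul_sub_mem`).

The ideal `I` of those `c` such that `c u^⊥` lies in the Siegel submodule does not change when `u`
is moved by an element of `H`. So its radical contains `⟨g u, h_k⟩` for all `g ∈ H` and all `k`,
and taking for `g` the Siegel transformation of a vector of the frame and `w ∈ Q` shows that it
also contains `⟨u, w⟩`. As `u` has a partner `u'` with `⟨u, u'⟩ = 1`, the ideal `I` is the unit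
ideal (`isFull_of_polar_eq_one`). No localization is needed, and the ring may be arbitrary.
-/

namespace RoyOrthogonal

open QuadraticMap

/-! ### Siegel transformations -/

section Siegel

variable {A : Type*} [CommRing A] {M : Type*} [AddCommGroup M] [Module A M]

/-- The Siegel transformation `x ↦ x + ⟨u, x⟩ v - ⟨v, x⟩ u - Φ(v) ⟨u, x⟩ u`. It is orthogonal when
`u` is isotropic and `⟨u, v⟩ = 0`; the formula is used for arbitrary `u` and `v`. -/
noncomputable def siegel (Φ : QuadraticForm A M) (u v : M) : M →ₗ[A] M :=
  LinearMap.id + (Φ.polarBilin u).smulRight v - (Φ.polarBilin v).smulRight u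
    - Φ v • (Φ.polarBilin u).smulRight u

variable {Φ : QuadraticForm A M}

theorem siegel_apply (u v x : M) :
    siegel Φ u v x = x + polar Φ u x • v - polar Φ v x • u - (Φ v * polar Φ u x) • u := by
  simp [siegel, mul_smul]

theorem polar_self_of_isotropic {u : M} (hu : Φ u = 0) : polar Φ u u = 0 := by
  rw [polar_self, hu, smul_zero]

theorem polar_map_map (g : orthogonalGroup Φ) (x y : M) :
    polar Φ (g.1 x) (g.1 y) = polar Φ x y := by
  simp only [polar, ← map_add, g.2 _]

theorem siegel_add {u v w : M} (hu : Φ u = 0) (hv : polar Φ u v = 0) (hw : polar Φ u w = 0)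
    (x : M) : siegel Φ u (v + w) x = siegel Φ u v (siegel Φ u w x) := by
  have huu := polar_self_of_isotropic hu
  have hvu : polar Φ v u = 0 := by rw [polar_comm, hv]
  simp only [siegel_apply, polar_add_left, polar_add_right, polar_sub_right, polar_smul_right,
    QuadraticMap.map_add Φ v w, huu, hw, hvu, smul_eq_mul]
  module

theorem siegel_smul_left (c : A) (u v x : M) : siegel Φ (c • u) v x = siegel Φ u (c • v) x := by
  simp only [siegel_apply, polar_smul_left, QuadraticMap.map_smul, smul_eq_mul]
  module

theorem siegel_swap {u v : M} (hu : Φ u = 0) (hv : Φ v = 0) (x : M) :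
    siegel Φ v (-u) x = siegel Φ u v x := by
  simp only [siegel_apply, polar_neg_left, QuadraticMap.map_neg, hu, hv]
  module

/-- Siegel transformations with a common second vector `w` multiply, for orthogonal isotropic
first vectors, up to a Siegel transformation in the plane of these two. -/
theorem siegel_add_left {a b w : M} (ha : Φ a = 0) (hb : Φ b = 0) (hab : polar Φ a b = 0)
    (haw : polar Φ a w = 0) (hbw : polar Φ b w = 0) (x : M) :
    siegel Φ (a + b) w x = siegel Φ a w (siegel Φ b w (siegel Φ b (Φ w • a) x)) := by
  have haa := polar_self_of_isotropic ha
  have hbb := polar_self_of_isotropic hb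
  have hba : polar Φ b a = 0 := by rw [polar_comm, hab]
  have hwa : polar Φ w a = 0 := by rw [polar_comm, haw]
  have hwb : polar Φ w b = 0 := by rw [polar_comm, hbw]
  have hww : polar Φ w w = 2 * Φ w := by rw [polar_self, nsmul_eq_mul, Nat.cast_ofNat]
  simp only [siegel_apply, polar_add_left, polar_add_right, polar_sub_right, polar_smul_right,
    polar_smul_left, QuadraticMap.map_smul, ha, hab, haa, hbb, hba, hwa, hwb, haw, hww,
    smul_eq_mul]
  module

/-- The Siegel transformation of `u` and `v` is (the linear map underlying) an element of `H`. -/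
def SiegelMem (H : Subgroup (orthogonalGroup Φ)) (u v : M) : Prop :=
  ∃ g ∈ H, ∀ x, g.1 x = siegel Φ u v x

variable {H : Subgroup (orthogonalGroup Φ)}

namespace SiegelMem

theorem zero (u : M) : SiegelMem H u 0 :=
  ⟨1, H.one_mem, fun x => by simp [siegel_apply]⟩

theorem add {u v w : M} (hu : Φ u = 0) (huv : polar Φ u v = 0) (huw : polar Φ u w = 0)
    (hv : SiegelMem H u v) (hw : SiegelMem H u w) : SiegelMem H u (v + w) := by
  obtain ⟨g, hg, hgx⟩ := hv
  obtain ⟨k, hk, hkx⟩ := hw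
  refine ⟨g * k, H.mul_mem hg hk, fun x => ?_⟩
  rw [siegel_add hu huv huw, ← hkx, ← hgx]
  rfl

theorem smul_left_iff {c : A} {u v : M} :
    SiegelMem H (c • u) v ↔ SiegelMem H u (c • v) := by
  simp only [SiegelMem, siegel_smul_left]

theorem swap {u v : M} (hu : Φ u = 0) (hv : Φ v = 0) (h : SiegelMem H u v) :
    SiegelMem H v (-u) := by
  obtain ⟨g, hg, hgx⟩ := h
  exact ⟨g, hg, fun x => by rw [hgx, siegel_swap hu hv]⟩

end SiegelMem

/-- Conjugation by an orthogonal transformation moves both vectors of a Siegel transformation. -/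
theorem conj_siegel (k g : orthogonalGroup Φ) {u v : M} (hg : ∀ x, g.1 x = siegel Φ u v x)
    (x : M) : (k * g * k⁻¹).1 x = siegel Φ (k.1 u) (k.1 v) x := by
  obtain ⟨y, rfl⟩ : ∃ y, x = k.1 y := ⟨k⁻¹.1 x, by
    change x = (k * k⁻¹).1 x
    rw [mul_inv_cancel]
    rfl⟩
  have h : (k * g * k⁻¹).1 (k.1 y) = k.1 (g.1 y) := by
    change (k * g * k⁻¹ * k).1 y = (k * g).1 y
    rw [inv_mul_cancel_right]
  rw [h, hg]
  simp only [siegel_apply, polar_map_map, map_add, map_sub, map_smul, k.2 v]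

theorem SiegelMem.conj {u v : M} (h : SiegelMem H u v) {k : orthogonalGroup Φ} (hk : k ∈ H) :
    SiegelMem H (k.1 u) (k.1 v) := by
  obtain ⟨g, hg, hgx⟩ := h
  exact ⟨k * g * k⁻¹, H.mul_mem (H.mul_mem hk hg) (H.inv_mem hk), conj_siegel k g hgx⟩

end Siegel

/-! ### Elementary isotropic vectors and Siegel submodules -/

section Elementary

variable {A : Type*} [CommRing A] {M : Type*} [AddCommGroup M] [Module A M]
  {Φ : QuadraticForm A M}

/-- The ideal generated by the values `⟨w, w'⟩` for `w` and `w'` in `Z`. -/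
def polarIdeal (Φ : QuadraticForm A M) (Z : Submodule A M) : Ideal A :=
  Ideal.span (Set.image2 (polar Φ) Z Z)

theorem polar_mem_polarIdeal {Z : Submodule A M} {w w' : M} (hw : w ∈ Z) (hw' : w' ∈ Z) :
    polar Φ w w' ∈ polarIdeal Φ Z :=
  Ideal.subset_span ⟨w, hw, w', hw', rfl⟩

/-- An isotropic vector orthogonal to `Z` all of whose Siegel transformations with second vector
in `Z` belong to `H`. -/
structure IsElementary (H : Subgroup (orthogonalGroup Φ)) (Z : Submodule A M) (a : M) : Prop where
  isotropic : Φ a = 0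
  polar_eq_zero : ∀ w ∈ Z, polar Φ a w = 0
  mem : ∀ w ∈ Z, SiegelMem H a w

variable {H : Subgroup (orthogonalGroup Φ)} {Z : Submodule A M}

/-- The commutator of the Siegel transformations of `(a, w)` and `(b, w')` is that of
`(a, ⟨w, w'⟩ b)` up to sign. -/
theorem IsElementary.siegelMem_smul {a b : M} (ha : IsElementary H Z a) (hb : IsElementary H Z b)
    (hab : polar Φ a b = 0) {t : A} (ht : t ∈ polarIdeal Φ Z) : SiegelMem H a (t • b) := by
  have key : ∀ w ∈ Z, ∀ w' ∈ Z, SiegelMem H a (polar Φ w w' • b) := by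
    intro w hw w' hw'
    obtain ⟨g, hg, hgx⟩ := hb.mem (-w) (Z.neg_mem hw)
    have h := (ha.mem w' hw').conj hg
    have h1 : g.1 a = a := by
      rw [hgx, siegel_apply, polar_comm Φ b a, hab, polar_neg_left, polar_comm Φ w,
        ha.polar_eq_zero w hw]
      simp
    have h2 : g.1 w' = w' + polar Φ w w' • b := by
      rw [hgx, siegel_apply, hb.polar_eq_zero w' hw', polar_neg_left]
      module
    rw [h1, h2] at h
    have h3 := SiegelMem.add ha.isotropic ?_ ?_ h (ha.mem (-w') (Z.neg_mem hw'))
    · rwa [add_neg_cancel_comm] at h3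
    · rw [polar_add_right, ha.polar_eq_zero w' hw', polar_smul_right, hab, smul_zero, add_zero]
    · rw [polar_neg_right, ha.polar_eq_zero w' hw', neg_zero]
  -- The `t` with this property form only an additive group a priori, hence the factor `c`.
  suffices h : ∀ c : A, SiegelMem H a ((c * t) • b) by simpa using h 1
  induction ht using Submodule.span_induction with
  | mem t ht =>
    obtain ⟨w, hw, w', hw', rfl⟩ := ht
    intro c
    rw [← smul_eq_mul, ← polar_smul_left]
    exact key _ (Z.smul_mem c hw) _ hw'
  | zero => simpa using SiegelMem.zero a
  | add s t _ _ hs ht =>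
    intro c
    rw [mul_add, add_smul]
    refine (hs c).add ha.isotropic ?_ ?_ (ht c) <;> rw [polar_smul_right, hab, smul_zero]
  | smul d t _ ht =>
    intro c
    rw [smul_eq_mul, ← mul_assoc]
    exact ht (c * d)

theorem IsElementary.smul {a : M} (ha : IsElementary H Z a) (c : A) :
    IsElementary H Z (c • a) where
  isotropic := by rw [QuadraticMap.map_smul, ha.isotropic, smul_zero]
  polar_eq_zero w hw := by rw [polar_smul_left, ha.polar_eq_zero w hw, smul_zero]
  mem w hw := SiegelMem.smul_left_iff.2 (ha.mem _ (Z.smul_mem c hw))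

theorem IsElementary.add [Invertible (2 : A)] {a b : M} (ha : IsElementary H Z a)
    (hb : IsElementary H Z b) (hab : polar Φ a b = 0) : IsElementary H Z (a + b) where
  isotropic := by rw [QuadraticMap.map_add Φ, ha.isotropic, hb.isotropic, hab]; simp
  polar_eq_zero w hw := by
    rw [polar_add_left, ha.polar_eq_zero w hw, hb.polar_eq_zero w hw, add_zero]
  mem w hw := by
    have hq : Φ w ∈ polarIdeal Φ Z := by
      have h : Φ w = ⅟(2 : A) * polar Φ w w := by
        rw [polar_self, nsmul_eq_mul, Nat.cast_ofNat, invOf_mul_cancel_left]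
      rw [h]
      exact Ideal.mul_mem_left _ _ (polar_mem_polarIdeal hw hw)
    obtain ⟨g₁, hg₁, h₁⟩ := ha.mem w hw
    obtain ⟨g₂, hg₂, h₂⟩ := hb.mem w hw
    obtain ⟨g₃, hg₃, h₃⟩ := hb.siegelMem_smul ha (by rw [polar_comm, hab]) hq
    refine ⟨g₁ * (g₂ * g₃), H.mul_mem hg₁ (H.mul_mem hg₂ hg₃), fun x => ?_⟩
    rw [siegel_add_left ha.isotropic hb.isotropic hab (ha.polar_eq_zero w hw)
      (hb.polar_eq_zero w hw), ← h₃, ← h₂, ← h₁]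
    rfl

/-- For an isotropic vector `u`, the vectors `v` orthogonal to `u` such that all Siegel
transformations of `u` and `t v`, with `t` in the polar ideal of `Z`, belong to `H`. -/
def siegelSubmodule (H : Subgroup (orthogonalGroup Φ)) (Z : Submodule A M) (u : M)
    (hu : Φ u = 0) : Submodule A M where
  carrier := {v | polar Φ u v = 0 ∧ ∀ t ∈ polarIdeal Φ Z, SiegelMem H u (t • v)}
  zero_mem' := ⟨polar_zero_right (Q := Φ) u, fun t _ => by rw [smul_zero]; exact SiegelMem.zero u⟩
  add_mem' := by
    rintro v w ⟨hv, hv'⟩ ⟨hw, hw'⟩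
    refine ⟨by rw [polar_add_right, hv, hw, add_zero], fun t ht => ?_⟩
    rw [smul_add]
    refine (hv' t ht).add hu ?_ ?_ (hw' t ht) <;> simp [polar_smul_right, hv, hw]
  smul_mem' := by
    rintro c v ⟨hv, hv'⟩
    refine ⟨by rw [polar_smul_right, hv, smul_zero], fun t ht => ?_⟩
    rw [smul_smul]
    exact hv' _ (Ideal.mul_mem_right c _ ht)

theorem mem_siegelSubmodule {u v : M} {hu : Φ u = 0} : v ∈ siegelSubmodule H Z u hu ↔
    polar Φ u v = 0 ∧ ∀ t ∈ polarIdeal Φ Z, SiegelMem H u (t • v) :=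
  Iff.rfl

theorem self_mem_siegelSubmodule {u : M} (hu : Φ u = 0) : u ∈ siegelSubmodule H Z u hu := by
  refine ⟨polar_self_of_isotropic hu, fun t _ => ⟨1, H.one_mem, fun x => ?_⟩⟩
  change x = _
  rw [siegel_apply, QuadraticMap.map_smul, hu, polar_smul_left, smul_eq_mul]
  module

theorem map_mem_siegelSubmodule {u v : M} {hu : Φ u = 0} (hv : v ∈ siegelSubmodule H Z u hu)
    {g : orthogonalGroup Φ} (hg : g ∈ H) :
    g.1 v ∈ siegelSubmodule H Z (g.1 u) ((g.2 u).trans hu) := by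
  refine ⟨by rw [polar_map_map, hv.1], fun t ht => ?_⟩
  rw [← map_smul]
  exact (hv.2 t ht).conj hg

namespace IsElementary

theorem mem_siegelSubmodule {a b : M} (ha : IsElementary H Z a) (hb : IsElementary H Z b)
    (hab : polar Φ a b = 0) : b ∈ siegelSubmodule H Z a ha.isotropic :=
  ⟨hab, fun _ ht => ha.siegelMem_smul hb hab ht⟩

theorem le_siegelSubmodule {a : M} (ha : IsElementary H Z a) :
    Z ≤ siegelSubmodule H Z a ha.isotropic :=
  fun w hw => ⟨ha.polar_eq_zero w hw, fun t _ => ha.mem _ (Z.smul_mem t hw)⟩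

end IsElementary

/-- An isotropic vector `u` whose Siegel submodule is the whole of `u^⊥`. -/
structure IsFull (H : Subgroup (orthogonalGroup Φ)) (Z : Submodule A M) (u : M) : Prop where
  isotropic : Φ u = 0
  mem : ∀ v, polar Φ u v = 0 → v ∈ siegelSubmodule H Z u isotropic

theorem IsFull.map {u : M} (h : IsFull H Z u) {g : orthogonalGroup Φ} (hg : g ∈ H) :
    IsFull H Z (g.1 u) where
  isotropic := (g.2 u).trans h.isotropic
  mem v hv := by
    obtain ⟨w, rfl⟩ := g.1.surjective v
    rw [polar_map_map] at hv
    exact map_mem_siegelSubmodule (h.mem w hv) hg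

/-- The symmetry between the two vectors of a Siegel transformation, both isotropic. -/
theorem IsFull.mem_siegelSubmodule {u v : M} (hv : IsFull H Z v) (hu : Φ u = 0)
    (huv : polar Φ u v = 0) : v ∈ siegelSubmodule H Z u hu := by
  refine ⟨huv, fun t ht => ?_⟩
  have h := (hv.mem u (by rw [polar_comm, huv])).2 (-t) ((polarIdeal Φ Z).neg_mem ht)
  have h' := SiegelMem.smul_left_iff.1 (h.swap hv.isotropic (by
    rw [QuadraticMap.map_smul, hu, smul_zero]))
  rwa [neg_smul_neg] at h'

end Elementary

/-! ### Hyperbolic frames -/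

section Frame

variable {A : Type*} [CommRing A] {M : Type*} [AddCommGroup M] [Module A M]
  {ι : Type*} [Fintype ι]

/-- A decomposition of the quadratic module `M` as the sum of `Z` and of hyperbolic planes with
bases `h k`, `h (bar k)`. The involution `bar` makes the two vectors of a hyperbolic pair play
symmetric roles. -/
structure IsHyperbolicFrame (Φ : QuadraticForm A M) (Z : Submodule A M) (bar : ι → ι)
    (h : ι → M) : Prop where
  bar_bar : ∀ k, bar (bar k) = k
  bar_ne : ∀ k, bar k ≠ k
  isotropic : ∀ k, Φ (h k) = 0
  polar_bar : ∀ k, polar Φ (h k) (h (bar k)) = 1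
  polar_ne : ∀ k l, l ≠ bar k → polar Φ (h k) (h l) = 0
  polar_eq_zero : ∀ k, ∀ w ∈ Z, polar Φ (h k) w = 0
  exists_eq : ∀ u, ∃ w ∈ Z, ∃ c : ι → A, u = w + ∑ k, c k • h k

variable {Φ : QuadraticForm A M} {Z : Submodule A M} {bar : ι → ι} {h : ι → M}
  {H : Subgroup (orthogonalGroup Φ)}

namespace IsHyperbolicFrame

theorem polar_sum (F : IsHyperbolicFrame Φ Z bar h) {w : M} (hw : w ∈ Z) (c : ι → A) (k : ι) :
    polar Φ (h k) (w + ∑ l, c l • h l) = c (bar k) := by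
  rw [polar_add_right, F.polar_eq_zero k w hw, zero_add, ← polarBilin_apply_apply, map_sum,
    Finset.sum_eq_single (bar k)]
  · rw [map_smul, polarBilin_apply_apply, F.polar_bar, smul_eq_mul, mul_one]
  · intro l _ hl
    rw [map_smul, polarBilin_apply_apply, F.polar_ne k l hl, smul_zero]
  · simp

theorem isElementary (F : IsHyperbolicFrame Φ Z bar h)
    (hH : ∀ k, ∀ w ∈ Z, SiegelMem H (h k) w) (k : ι) : IsElementary H Z (h k) :=
  ⟨F.isotropic k, F.polar_eq_zero k, hH k⟩

variable [Invertible (2 : A)]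

/-- A vector orthogonal to `s h_l + c h_k` is a sum of an element of `Z`, of multiples of those
`h_n` orthogonal to both `h_k` and `h_l`, and of a single combination of `h_{bar k}` and
`h_{bar l}` which is itself elementary. -/
theorem isFull (F : IsHyperbolicFrame Φ Z bar h) (hH : ∀ k, ∀ w ∈ Z, SiegelMem H (h k) w)
    {k l : ι} (hkl : l ≠ k) (hkl' : l ≠ bar k) (s c : A) : IsFull H Z (s • h l + c • h k) := by
  classical
  have hlk' : k ≠ bar l := fun e => hkl' (by rw [e, F.bar_bar])
  have hbar : bar k ≠ bar l := fun e => hkl (by rw [← F.bar_bar k, e, F.bar_bar])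
  have E := F.isElementary hH
  have ha : IsElementary H Z (s • h l + c • h k) :=
    ((E l).smul s).add ((E k).smul c) (by
      rw [polar_smul_left, polar_smul_right, F.polar_ne l k hlk', smul_zero, smul_zero])
  refine ⟨ha.isotropic, fun y hy => ?_⟩
  obtain ⟨w, hw, d, rfl⟩ := F.exists_eq y
  rw [polar_add_left, polar_smul_left, polar_smul_left, F.polar_sum hw, F.polar_sum hw,
    smul_eq_mul, smul_eq_mul] at hy
  refine Submodule.add_mem _ (ha.le_siegelSubmodule hw) ?_
  rw [← Finset.add_sum_erase _ _ (Finset.mem_univ (bar k)),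
    ← Finset.add_sum_erase _ _ (Finset.mem_erase.2 ⟨hbar.symm, Finset.mem_univ (bar l)⟩),
    ← add_assoc]
  refine Submodule.add_mem _ (ha.mem_siegelSubmodule
    (((E _).smul _).add ((E _).smul _) ?_) ?_) (Submodule.sum_mem _ fun n hn => ?_)
  · rw [polar_smul_left, polar_smul_right, F.polar_ne (bar k) (bar l), smul_zero, smul_zero]
    rw [F.bar_bar]
    exact hlk'.symm
  · simp only [polar_add_left, polar_add_right, polar_smul_left, polar_smul_right, F.polar_bar,
      F.polar_ne l (bar k) hbar, F.polar_ne k (bar l) hbar.symm, smul_eq_mul]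
    linear_combination hy
  · obtain ⟨hnl, hnk, -⟩ := by simpa only [Finset.mem_erase] using hn
    refine Submodule.smul_mem _ _ (ha.mem_siegelSubmodule (E n) ?_)
    rw [polar_add_left, polar_smul_left, polar_smul_left, F.polar_ne l n hnl, F.polar_ne k n hnk,
      smul_zero, smul_zero, add_zero]

variable (F : IsHyperbolicFrame Φ Z bar h) (hH : ∀ k, ∀ w ∈ Z, SiegelMem H (h k) w)
  (hbar : ∀ k, ∃ l, l ≠ k ∧ l ≠ bar k)

include F hH in
theorem smul_sub_mem_of_ne {u : M} (hu : Φ u = 0) {k l : ι} (hkl : l ≠ k) (hkl' : l ≠ bar k) :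
    polar Φ u (h k) • h l - polar Φ u (h l) • h k ∈ siegelSubmodule H Z u hu := by
  have h1 := F.isFull hH hkl hkl' (polar Φ u (h k)) (-polar Φ u (h l))
  rw [neg_smul, ← sub_eq_add_neg] at h1
  refine h1.mem_siegelSubmodule hu ?_
  rw [polar_sub_right, polar_smul_right, polar_smul_right, smul_eq_mul, smul_eq_mul]
  ring

include F hH hbar in
/-- The image of a vector `s h_l + c h_k`, with `c` chosen to make it orthogonal to `u`, under the
Siegel transformation of `h_{bar l}` and `w`, differs from `s w - ⟨u, w⟩ h_k` by a combination of
the vectors `s h_n - ⟨u, h_n⟩ h_k` with `n` equal to `l` or `bar l`. -/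
theorem smul_sub_mem_of_mem {u : M} (hu : Φ u = 0) (k : ι) {w : M} (hw : w ∈ Z) :
    polar Φ u (h k) • w - polar Φ u w • h k ∈ siegelSubmodule H Z u hu := by
  obtain ⟨l, hkl, hkl'⟩ := hbar k
  have hlk : bar l ≠ k := fun e => hkl' (by rw [← e, F.bar_bar])
  have hlk' : bar l ≠ bar k := fun e => hkl (by rw [← F.bar_bar l, e, F.bar_bar])
  obtain ⟨g, hg, hgx⟩ := hH (bar l) w hw
  have hgl : g.1 (h l) = h l + w - Φ w • h (bar l) := by
    have h1 := F.polar_bar (bar l)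
    rw [F.bar_bar] at h1
    rw [hgx, siegel_apply, h1, polar_comm Φ w, F.polar_eq_zero l w hw]
    module
  have hgk : g.1 (h k) = h k := by
    rw [hgx, siegel_apply, F.polar_ne (bar l) k (by rwa [F.bar_bar, ne_comm]), polar_comm Φ w,
      F.polar_eq_zero k w hw]
    module
  have h1 := (F.isFull hH hkl hkl' (polar Φ u (h k))
    (-(polar Φ u (h l) + polar Φ u w - Φ w * polar Φ u (h (bar l))))).map hg
  rw [map_add, map_smul, map_smul, hgl, hgk] at h1
  have h2 := h1.mem_siegelSubmodule hu (by
    simp only [polar_add_right, polar_sub_right, polar_smul_right, smul_eq_mul]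
    ring)
  have h3 := Submodule.add_mem _ (Submodule.sub_mem _ h2 (F.smul_sub_mem_of_ne hH hu hkl hkl'))
    (Submodule.smul_mem _ (Φ w) (F.smul_sub_mem_of_ne hH hu hlk hlk'))
  convert h3 using 1
  module

include F hH hbar in
/-- For `n ≠ bar k` the vectors `s h_n - ⟨u, h_n⟩ h_k`, where `s = ⟨u, h_k⟩`, lie in the Siegel
submodule. As `s` is the coefficient of `h_{bar k}` in `u`, the remaining case follows after
multiplication by `s` from `u` being in the Siegel submodule. -/
theorem smul_smul_sub_mem {u : M} (hu : Φ u = 0) (k : ι) (v : M) :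
    polar Φ u (h k) • (polar Φ u (h k) • v - polar Φ u v • h k) ∈ siegelSubmodule H Z u hu := by
  classical
  set s := polar Φ u (h k) with hs
  -- The claim is linear in `v`, so it is enough to check it on `Z` and on the frame.
  let D : M →ₗ[A] M := s • LinearMap.id - (Φ.polarBilin u).smulRight (h k)
  have hD : ∀ v, D v = s • v - polar Φ u v • h k := fun v => by simp [D]
  have hZ : ∀ w ∈ Z, D w ∈ siegelSubmodule H Z u hu := fun w hw => by
    rw [hD]
    exact F.smul_sub_mem_of_mem hH hbar hu k hw
  have hne : ∀ n, n ≠ bar k → D (h n) ∈ siegelSubmodule H Z u hu := fun n hn => by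
    rw [hD]
    by_cases hnk : n = k
    · subst hnk
      rw [← hs, sub_self]
      exact Submodule.zero_mem _
    · exact F.smul_sub_mem_of_ne hH hu hnk hn
  have hbark : s • D (h (bar k)) ∈ siegelSubmodule H Z u hu := by
    obtain ⟨w, hw, c, hc⟩ := F.exists_eq u
    have hck : c (bar k) = s := by
      rw [hs, polar_comm Φ u, ← F.polar_sum hw c k, ← hc]
    have h1 : D u ∈ siegelSubmodule H Z u hu := by
      rw [hD, polar_self_of_isotropic hu, zero_smul, sub_zero]
      exact Submodule.smul_mem _ _ (self_mem_siegelSubmodule hu)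
    have h2 : D u = D w + (s • D (h (bar k)) +
        ∑ n ∈ Finset.univ.erase (bar k), c n • D (h n)) := by
      conv_lhs => rw [hc]
      rw [map_add, map_sum, ← Finset.add_sum_erase _ _ (Finset.mem_univ (bar k)), map_smul, hck]
      simp only [map_smul]
    rw [h2, Submodule.add_mem_iff_right _ (hZ w hw), Submodule.add_mem_iff_left] at h1
    · exact h1
    · exact Submodule.sum_mem _ fun n hn =>
        Submodule.smul_mem _ _ (hne n (Finset.ne_of_mem_erase hn))
  rw [← hD]
  obtain ⟨w, hw, c, rfl⟩ := F.exists_eq v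
  rw [map_add, map_sum, smul_add, Finset.smul_sum]
  refine Submodule.add_mem _ (Submodule.smul_mem _ _ (hZ w hw)) (Submodule.sum_mem _ fun n _ => ?_)
  rw [map_smul, smul_comm]
  refine Submodule.smul_mem _ _ ?_
  by_cases hn : n = bar k
  · rw [hn]
    exact hbark
  · exact Submodule.smul_mem _ _ (hne n hn)

include F hH hbar in
/-- The ideal of those `c` with `c u^⊥` in the Siegel submodule of `u` does not change when `u`
is moved by `H`. It contains `⟨u, h_k⟩²`. The Siegel transformation `g` of `h_k` and `w` satisfies
`⟨g u, h_{bar k}⟩ = ⟨u, h_{bar k}⟩ - ⟨u, w⟩ - Φ(w) ⟨u, h_k⟩`, so the radical contains `⟨u, w⟩` as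
well, hence all values `⟨u, x⟩`. -/
theorem isFull_of_polar_eq_one [Nonempty ι] {u u' : M} (hu : Φ u = 0)
    (huu' : polar Φ u u' = 1) : IsFull H Z u := by
  let I : Ideal A :=
    { carrier := {c | ∀ v, polar Φ u v = 0 → c • v ∈ siegelSubmodule H Z u hu}
      zero_mem' := fun v _ => by rw [zero_smul]; exact Submodule.zero_mem _
      add_mem' := fun {c d} hc hd v hv => by
        rw [add_smul]; exact Submodule.add_mem _ (hc v hv) (hd v hv)
      smul_mem' := fun c d hd v hv => by
        rw [smul_assoc]; exact Submodule.smul_mem _ _ (hd v hv) }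
  have hmove : ∀ g ∈ H, ∀ k, polar Φ (g.1 u) (h k) ∈ I.radical := by
    intro g hg k
    refine ⟨2, fun v hv => ?_⟩
    have h1 := F.smul_smul_sub_mem hH hbar ((g.2 u).trans hu) k (g.1 v)
    rw [polar_map_map, hv, zero_smul, sub_zero, smul_smul, ← pow_two] at h1
    have h2 := map_mem_siegelSubmodule h1 (H.inv_mem hg)
    have hinv : ∀ x, (g⁻¹).1 (g.1 x) = x := fun x => by
      change (g⁻¹ * g).1 x = x
      rw [inv_mul_cancel]
      rfl
    simpa only [map_smul, hinv] using h2
  have hh : ∀ k, polar Φ u (h k) ∈ I.radical := fun k => hmove 1 H.one_mem k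
  have hZ : ∀ w ∈ Z, polar Φ u w ∈ I.radical := by
    intro w hw
    obtain ⟨k⟩ := ‹Nonempty ι›
    obtain ⟨g, hg, hgx⟩ := hH k w hw
    have h1 := hmove g hg (bar k)
    have h2 : polar Φ u w = polar Φ u (h (bar k)) - Φ w * polar Φ u (h k)
        - polar Φ (g.1 u) (h (bar k)) := by
      rw [hgx, siegel_apply]
      simp only [polar_add_left, polar_sub_left, polar_smul_left, F.polar_bar, smul_eq_mul,
        polar_comm Φ w (h _), F.polar_eq_zero _ w hw, polar_comm Φ (h k) u, polar_comm Φ w u]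
      ring
    rw [h2]
    exact Ideal.sub_mem _ (Ideal.sub_mem _ (hh _) (Ideal.mul_mem_left _ _ (hh k))) h1
  have hone : (1 : A) ∈ I.radical := by
    obtain ⟨w, hw, c, rfl⟩ := F.exists_eq u'
    rw [← huu', polar_add_right, ← polarBilin_apply_apply _ u (∑ k, _), map_sum]
    refine Ideal.add_mem _ (hZ w hw) (Ideal.sum_mem _ fun k _ => ?_)
    rw [map_smul]
    exact Ideal.mul_mem_left _ _ (hh k)
  obtain ⟨n, hn⟩ := hone
  rw [one_pow] at hn
  exact ⟨hu, fun v hv => by simpa only [one_smul] using hn v hv⟩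

end IsHyperbolicFrame

end Frame

/-! ### Normal cores and products of Siegel transformations -/

section NormalCore

variable {A : Type*} [CommRing A] {M : Type*} [AddCommGroup M] [Module A M]
  {Φ : QuadraticForm A M} {Z : Submodule A M} {H : Subgroup (orthogonalGroup Φ)}

theorem SiegelMem.normalCore {u v : M}
    (h : ∀ g : orthogonalGroup Φ, SiegelMem H (g.1 u) (g.1 v)) : SiegelMem H.normalCore u v := by
  obtain ⟨k, -, hkx⟩ := h 1
  refine ⟨k, fun g => ?_, hkx⟩
  obtain ⟨k', hk', hkx'⟩ := h g
  have hk : g * k * g⁻¹ = k' := Subtype.ext (LinearEquiv.ext fun x => by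
    rw [conj_siegel g k hkx, hkx']
    rfl)
  rwa [hk]

theorem IsFull.siegelMem_map {u : M} {g : orthogonalGroup Φ} (h : IsFull H Z (g.1 u)) {y : M}
    (hy : y ∈ polarIdeal Φ Z • LinearMap.ker (Φ.polarBilin u)) :
    SiegelMem H (g.1 u) (g.1 y) := by
  have hker : ∀ v ∈ LinearMap.ker (Φ.polarBilin u), polar Φ (g.1 u) (g.1 v) = 0 := fun v hv => by
    rw [polar_map_map]
    exact hv
  refine (?_ : polar Φ (g.1 u) (g.1 y) = 0 ∧ SiegelMem H (g.1 u) (g.1 y)).2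
  induction hy using Submodule.smul_induction_on' with
  | smul t ht v hv =>
    rw [map_smul, polar_smul_right, hker v hv, smul_zero]
    exact ⟨rfl, (h.mem _ (hker v hv)).2 t ht⟩
  | add v _ w _ hv hw =>
    rw [map_add, polar_add_right, hv.1, hw.1, add_zero]
    exact ⟨rfl, hv.2.add h.isotropic hv.1 hw.1 hw.2⟩

theorem IsHyperbolicFrame.siegelMem_normalCore [Invertible (2 : A)] {ι : Type*} [Fintype ι]
    {bar : ι → ι} {h : ι → M} (F : IsHyperbolicFrame Φ Z bar h)
    (hH : ∀ k, ∀ w ∈ Z, SiegelMem H (h k) w) (hbar : ∀ k, ∃ l, l ≠ k ∧ l ≠ bar k) (k : ι) {y : M}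
    (hy : y ∈ polarIdeal Φ Z • LinearMap.ker (Φ.polarBilin (h k))) :
    SiegelMem H.normalCore (h k) y := by
  have : Nonempty ι := ⟨k⟩
  refine SiegelMem.normalCore fun g => IsFull.siegelMem_map ?_ hy
  exact F.isFull_of_polar_eq_one hH hbar ((g.2 _).trans (F.isotropic k))
    ((polar_map_map g _ _).trans (F.polar_bar k))

end NormalCore

section Eichler

variable {A : Type*} [CommRing A] [Invertible (2 : A)] {M : Type*} [AddCommGroup M] [Module A M]

/-- The map `1 + γ - α - (1/2) α γ`. Roy's transformations have this form, with `γ` the adjoint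
of `α`. -/
def eichler (α γ : M →ₗ[A] M) (x : M) : M :=
  x + γ x - α x - ⅟(2 : A) • α (γ x)

/-- The linear map `x ↦ ∑ ⟨w i, x⟩ a i`. -/
noncomputable def polarSum {κ : Type*} (Φ : QuadraticForm A M) (s : Finset κ) (w a : κ → M) :
    M →ₗ[A] M :=
  ∑ i ∈ s, (Φ.polarBilin (w i)).smulRight (a i)

variable {Φ : QuadraticForm A M}

/-- Adding a rank one term to `α` multiplies the transformation by a Siegel transformation, up to
a correction which is again a Siegel transformation. -/
theorem eichler_add {α γ : M →ₗ[A] M} (hadj : ∀ x y, polar Φ (α x) y = polar Φ x (γ y))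
    (hΦ : ∀ x, Φ (α x) = 0) (hαα : ∀ x, α (α x) = 0) (hγα : ∀ x, γ (α x) = 0) {a w : M}
    (ha : Φ a = 0) (haw : polar Φ a w = 0) (hαa : α a = 0) (hγa : γ a = 0) (hγw : γ w = 0)
    (x : M) :
    eichler (α + (Φ.polarBilin w).smulRight a) (γ + (Φ.polarBilin a).smulRight w) x =
      eichler α γ (siegel Φ a w (siegel Φ a (⅟(2 : A) • α w) x)) := by
  have haa := polar_self_of_isotropic ha
  have hwa : polar Φ w a = 0 := by rw [polar_comm, haw]
  have h1 : polar Φ a (α w) = 0 := by rw [polar_comm, hadj, hγa, polar_zero_right]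
  have h2 : polar Φ w (α w) = 0 := by rw [polar_comm, hadj, hγw, polar_zero_right]
  have h3 : polar Φ w (γ x) = polar Φ (α w) x := (hadj w x).symm
  have h4 : polar Φ w w = 2 * Φ w := by rw [polar_self, nsmul_eq_mul, Nat.cast_ofNat]
  have h5 : ∀ c : A, ⅟(2 : A) * (c * (2 * Φ w)) = c * Φ w := fun c => by
    rw [mul_left_comm, invOf_mul_cancel_left]
  simp only [eichler, siegel_apply, LinearMap.add_apply, LinearMap.smulRight_apply,
    polarBilin_apply_apply, map_add, map_sub, map_smul, polar_smul_left,
    QuadraticMap.map_smul, hΦ, hαα, hγα, hαa, hγa, hγw, haa, hwa, h1, h2, h3, h4, smul_eq_mul,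
    smul_add, smul_smul, h5, zero_smul, smul_zero, mul_zero, zero_mul, add_zero, sub_zero]
  match_scalars <;>
    first
    | ring1
    | linear_combination (-polar Φ a x) * mul_invOf_self (2 : A)

omit [Invertible (2 : A)] in
theorem polarSum_apply {κ : Type*} (s : Finset κ) (w a : κ → M) (x : M) :
    polarSum Φ s w a x = ∑ i ∈ s, polar Φ (w i) x • a i := by
  simp [polarSum]

theorem exists_eichler {κ : Type*} [DecidableEq κ] {K : Subgroup (orthogonalGroup Φ)}
    {a w : κ → M}
    (ha : ∀ i, Φ (a i) = 0) (haa : ∀ i j, polar Φ (a i) (a j) = 0)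
    (haw : ∀ i j, polar Φ (a i) (w j) = 0) (hK : ∀ i, SiegelMem K (a i) (w i))
    (hK' : ∀ i j (c : A), SiegelMem K (a i) ((c * polar Φ (w j) (w i)) • a j)) (s : Finset κ) :
    ∃ g ∈ K, ∀ x, g.1 x = eichler (polarSum Φ s w a) (polarSum Φ s a w) x := by
  have hsum : ∀ (s : Finset κ) (f : κ → M) (y : M),
      polar Φ y (∑ i ∈ s, f i) = ∑ i ∈ s, polar Φ y (f i) := fun s f y => by
    rw [← polarBilin_apply_apply, map_sum]
    rfl
  induction s using Finset.induction_on with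
  | empty => exact ⟨1, K.one_mem, fun x => by simp [polarSum, eichler]⟩
  | insert i s hi ih =>
    obtain ⟨g₁, hg₁, h₁⟩ := ih
    obtain ⟨g₂, hg₂, h₂⟩ := hK i
    have hcorr : SiegelMem K (a i) (⅟(2 : A) • polarSum Φ s w a (w i)) := by
      rw [polarSum_apply, Finset.smul_sum]
      simp only [smul_smul]
      clear h₁ h₂ hi
      refine (?_ : polar Φ (a i) (∑ j ∈ s, (⅟(2 : A) * polar Φ (w j) (w i)) • a j) = 0 ∧
        SiegelMem K (a i) (∑ j ∈ s, (⅟(2 : A) * polar Φ (w j) (w i)) • a j)).2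
      refine Finset.sum_induction _ (fun v => polar Φ (a i) v = 0 ∧ SiegelMem K (a i) v) ?_ ?_ ?_
      · rintro v v' ⟨hv, hv'⟩ ⟨hw, hw'⟩
        exact ⟨by rw [polar_add_right, hv, hw, add_zero], hv'.add (ha i) hv hw hw'⟩
      · exact ⟨polar_zero_right (Q := Φ) _, SiegelMem.zero _⟩
      · intro j _
        exact ⟨by rw [polar_smul_right, haa, smul_zero], hK' i j _⟩
    obtain ⟨g₃, hg₃, h₃⟩ := hcorr
    refine ⟨g₁ * (g₂ * g₃), K.mul_mem hg₁ (K.mul_mem hg₂ hg₃), fun x => ?_⟩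
    have hwa : ∀ i j, polar Φ (w i) (a j) = 0 := fun i j => by rw [polar_comm, haw]
    have hself : ∀ y, polar Φ (polarSum Φ s w a y) (polarSum Φ s w a y) = 0 := fun y => by
      simp only [polarSum_apply, hsum, polar_smul_right]
      refine Finset.sum_eq_zero fun j _ => ?_
      rw [polar_comm Φ _ (a j), hsum, Finset.sum_eq_zero, smul_zero]
      intro l _
      rw [polar_smul_right, haa, smul_zero]
    have hins : ∀ b c : κ → M, polarSum Φ (insert i s) b c =
        polarSum Φ s b c + (Φ.polarBilin (b i)).smulRight (c i) := fun b c => by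
      rw [polarSum, Finset.sum_insert hi, add_comm]
      rfl
    rw [hins, hins, eichler_add, ← h₃, ← h₂, ← h₁]
    · rfl
    · intro x y
      rw [polar_comm]
      simp only [polarSum_apply, hsum, polar_smul_right, smul_eq_mul]
      refine Finset.sum_congr rfl fun j _ => ?_
      rw [polar_comm Φ y, polar_comm Φ x, mul_comm]
    · intro y
      have h := hself y
      rw [polar_self, nsmul_eq_mul, Nat.cast_ofNat] at h
      rw [← invOf_mul_cancel_left (2 : A) (Φ _), h, mul_zero]
    · intro y
      simp [polarSum_apply, hwa]
    · intro y
      simp [polarSum_apply, haa]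
    · exact ha i
    · exact haw i i
    · simp [polarSum_apply, hwa]
    · simp [polarSum_apply, haa]
    · simp [polarSum_apply, haw]

end Eichler

/-! ### The hyperbolic sum with a free module -/

section HyperbolicSum

variable {A : Type*} [CommRing A] {Q : Type*} [AddCommGroup Q] [Module A Q]
  {P : Type*} [AddCommGroup P] [Module A P] (q : QuadraticForm A Q)

theorem hyperbolicSum_apply (v : Q × (Module.Dual A P × P)) :
    hyperbolicSum q P v = q v.1 + v.2.1 v.2.2 := by
  simp [hyperbolicSum]

theorem polar_hyperbolicSum (v w : Q × (Module.Dual A P × P)) :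
    polar (hyperbolicSum q P) v w = polar q v.1 w.1 + (v.2.1 w.2.2 + w.2.1 v.2.2) := by
  simp only [polar, hyperbolicSum_apply, Prod.fst_add, Prod.snd_add, LinearMap.add_apply, map_add]
  ring

variable (A) in
/-- The standard basis vectors of `P = Aᵐ` and of its dual, in the hyperbolic sum. -/
def frameVec (Q : Type*) [AddCommGroup Q] [Module A Q] (m : ℕ) :
    Fin m ⊕ Fin m → Q × (Module.Dual A (Fin m → A) × (Fin m → A)) :=
  Sum.elim (fun i => (0, (0, Pi.single i 1))) (fun i => (0, (LinearMap.proj i, 0)))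

theorem isHyperbolicFrame (m : ℕ) : IsHyperbolicFrame (hyperbolicSum q (Fin m → A))
    (LinearMap.range (LinearMap.inl A Q _)) Sum.swap (frameVec A Q m) where
  bar_bar := Sum.swap_swap
  bar_ne := by rintro (i | i) <;> simp
  isotropic := by rintro (i | i) <;> simp [frameVec, hyperbolicSum_apply]
  polar_bar := by rintro (i | i) <;> simp [frameVec, polar_hyperbolicSum]
  polar_ne := by
    rintro (i | i) (j | j) hij <;>
      simp_all [frameVec, polar_hyperbolicSum, eq_comm]
  polar_eq_zero := by
    rintro (i | i) _ ⟨z, rfl⟩ <;> simp [frameVec, polar_hyperbolicSum]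
  exists_eq := by
    rintro ⟨z, f, x⟩
    refine ⟨_, ⟨z, rfl⟩, Sum.elim x (fun i => f (Pi.single i 1)), ?_⟩
    rw [Fintype.sum_sum_type]
    ext1
    · simp [frameVec, Prod.fst_sum]
    · ext1
      · ext i
        simp [frameVec, Prod.fst_sum, Prod.snd_sum, Pi.single_apply]
      · ext i
        simp [frameVec, Prod.snd_sum, Pi.single_apply]

/-- A projective module is the product of itself with its trace ideal, which for a non-singular
form is generated by the values of the bilinear form. -/
theorem range_inl_le_smul [Module.Projective A Q] (hq : Nonsingular q)
    {N : Submodule A (Q × (Module.Dual A P × P))}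
    (hN : LinearMap.range (LinearMap.inl A Q _) ≤ N) :
    LinearMap.range (LinearMap.inl A Q _) ≤
      polarIdeal (hyperbolicSum q P) (LinearMap.range (LinearMap.inl A Q _)) • N := by
  rintro _ ⟨z, rfl⟩
  obtain ⟨s, hs⟩ := Module.projective_def.1 ‹Module.Projective A Q›
  rw [← hs z, Finsupp.linearCombination_apply, Finsupp.sum, map_sum]
  refine Submodule.sum_mem _ fun p _ => ?_
  rw [map_smul]
  refine Submodule.smul_mem_smul ?_ (hN ⟨p, rfl⟩)
  obtain ⟨y, hy⟩ := hq.2 (Finsupp.lapply p ∘ₗ s)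
  have h : s z p = polar (hyperbolicSum q P) (LinearMap.inl A Q _ y) (LinearMap.inl A Q _ z) := by
    simpa [polar_hyperbolicSum] using (LinearMap.congr_fun hy z).symm
  rw [h]
  exact polar_mem_polarIdeal ⟨y, rfl⟩ ⟨z, rfl⟩

variable (hq : Nonsingular q)

theorem adjoint_eq_of_forall (α : Q →ₗ[A] P) (f : Module.Dual A P) (w : Q)
    (h : ∀ z, f (α z) = polar q w z) : adjoint q hq α f = w := by
  refine hq.1 (LinearMap.ext fun z => ?_)
  rw [polarBilin_apply_apply, polarBilin_apply_apply, polar_adjoint, h]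

theorem adjointDual_eq_of_forall (β : Q →ₗ[A] Module.Dual A P) (x : P) (w : Q)
    (h : ∀ z, β z x = polar q w z) : adjointDual q hq β x = w := by
  refine hq.1 (LinearMap.ext fun z => ?_)
  rw [polarBilin_apply_apply, polarBilin_apply_apply, polar_adjointDual, h]

variable [Invertible (2 : A)]

theorem siegelMem_frameVec (m : ℕ) (k : Fin m ⊕ Fin m) :
    ∀ w ∈ LinearMap.range (LinearMap.inl A Q _),
      SiegelMem (elementaryOrthogonalGroup q hq (Fin m → A)) (frameVec A Q m k) w := by
  have hhalf : ∀ c d : A, ⅟(2 : A) * (c * (2 * d)) = c * d := fun c d => by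
    rw [mul_left_comm, invOf_mul_cancel_left]
  rintro _ ⟨w, rfl⟩
  obtain i | i := k
  · refine ⟨_, Subgroup.subset_closure
      (Or.inl ⟨-(q.polarBilin w).smulRight (Pi.single i 1), rfl⟩), ?_⟩
    rintro ⟨z, f, x⟩
    change elemMap q hq _ _ = _
    have h := adjoint_eq_of_forall q hq
      (-(q.polarBilin w).smulRight (Pi.single i 1 : Fin m → A)) f (-f (Pi.single i 1) • w)
      (fun z => by simp [polar_smul_left, mul_comm])
    simp only [elemMap, LinearMap.coe_mk, AddHom.coe_mk, h]
    ext1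
    · simp [siegel_apply, frameVec, polar_hyperbolicSum]
    · ext1
      · simp [siegel_apply, frameVec, polar_hyperbolicSum]
      · simp [siegel_apply, frameVec, polar_hyperbolicSum, hyperbolicSum_apply,
          polar_smul_right, smul_smul, hhalf, mul_comm (q w), sub_eq_add_neg]
  · refine ⟨_, Subgroup.subset_closure
      (Or.inr ⟨-(q.polarBilin w).smulRight (LinearMap.proj i), rfl⟩), ?_⟩
    rintro ⟨z, f, x⟩
    change elemDualMap q hq _ _ = _
    have h := adjointDual_eq_of_forall q hq
      (-(q.polarBilin w).smulRight (LinearMap.proj i : Module.Dual A (Fin m → A))) x (-x i • w)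
      (fun z => by simp [polar_smul_left, mul_comm])
    simp only [elemDualMap, LinearMap.coe_mk, AddHom.coe_mk, h]
    ext1
    · simp [siegel_apply, frameVec, polar_hyperbolicSum]
    · ext1
      · simp [siegel_apply, frameVec, polar_hyperbolicSum, hyperbolicSum_apply,
          polar_smul_right, smul_smul, hhalf, mul_comm (q w), sub_eq_add_neg]
      · simp [siegel_apply, frameVec, polar_hyperbolicSum]

omit [Invertible (2 : A)] in
theorem dual_apply_eq_sum {m : ℕ} (f : Module.Dual A (Fin m → A)) (x : Fin m → A) :
    f x = ∑ i, f (Pi.single i 1) * x i := by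
  conv_lhs => rw [pi_eq_sum_univ' x]
  simp only [map_sum, map_smul, smul_eq_mul, mul_comm]

/-- A transformation whose `α` takes values in the span of mutually orthogonal vectors of the frame
is a product of Siegel transformations of these vectors. The corrections in the product formula
have their second vector in the polar ideal times the span of the frame. -/
theorem mem_of_eichler [Module.Projective A Q] (hq : Nonsingular q) {m : ℕ}
    {K : Subgroup (orthogonalGroup (hyperbolicSum q (Fin m → A)))}
    (hK : ∀ k, ∀ y ∈ polarIdeal (hyperbolicSum q (Fin m → A))
        (LinearMap.range (LinearMap.inl A Q _)) •
      LinearMap.ker ((hyperbolicSum q (Fin m → A)).polarBilin (frameVec A Q m k)),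
        SiegelMem K (frameVec A Q m k) y)
    {g : orthogonalGroup (hyperbolicSum q (Fin m → A))} (e : Fin m → Fin m ⊕ Fin m)
    (he : ∀ i j, e j ≠ Sum.swap (e i)) (w : Fin m → Q)
    (hg : ∀ v, g.1 v = eichler
      (polarSum (hyperbolicSum q (Fin m → A)) Finset.univ (fun i => (w i, (0, 0)))
        (fun i => frameVec A Q m (e i)))
      (polarSum (hyperbolicSum q (Fin m → A)) Finset.univ (fun i => frameVec A Q m (e i))
        (fun i => (w i, (0, 0)))) v) : g ∈ K := by
  have F := isHyperbolicFrame q m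
  obtain ⟨g', hg', h⟩ := exists_eichler (K := K) (Φ := hyperbolicSum q (Fin m → A))
    (a := fun i => frameVec A Q m (e i)) (w := fun i => (w i, (0, 0)))
    (fun i => F.isotropic _) (fun i j => F.polar_ne _ _ (he i j))
    (fun i j => F.polar_eq_zero _ _ ⟨w j, rfl⟩)
    (fun i => hK _ _ (range_inl_le_smul q hq (fun z hz => F.polar_eq_zero _ z hz) ⟨w i, rfl⟩))
    (fun i j c => hK _ _ (Submodule.smul_mem_smul
      (Ideal.mul_mem_left _ _ (polar_mem_polarIdeal ⟨w j, rfl⟩ ⟨w i, rfl⟩))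
      (F.polar_ne _ _ (he i j)))) Finset.univ
  have : g = g' := Subtype.ext (LinearEquiv.ext fun v => by rw [hg, h])
  rwa [this]

theorem elem_mem [Module.Projective A Q] {m : ℕ}
    {K : Subgroup (orthogonalGroup (hyperbolicSum q (Fin m → A)))}
    (hK : ∀ k, ∀ y ∈ polarIdeal (hyperbolicSum q (Fin m → A))
        (LinearMap.range (LinearMap.inl A Q _)) •
      LinearMap.ker ((hyperbolicSum q (Fin m → A)).polarBilin (frameVec A Q m k)),
        SiegelMem K (frameVec A Q m k) y) (α : Q →ₗ[A] Fin m → A) : elem q hq α ∈ K := by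
  let y : Fin m → Q := fun i => (dualEquiv q hq).symm (LinearMap.proj i ∘ₗ α)
  have hy : ∀ i z, polar q (y i) z = α z i := fun i z => polar_dualEquiv_symm q hq _ z
  refine mem_of_eichler q hq hK Sum.inl (by simp) (fun i => -y i) ?_
  rintro ⟨z, f, x⟩
  have hα : ∀ v, polarSum (hyperbolicSum q (Fin m → A)) Finset.univ (fun i => (-y i, (0, 0)))
      (fun i => frameVec A Q m (Sum.inl i)) v = (0, (0, -α v.1)) := fun v => by
    rw [polarSum_apply]
    ext1
    · simp [frameVec, Prod.fst_sum]
    · ext1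
      · simp [frameVec, Prod.fst_sum, Prod.snd_sum]
      · ext i
        simp [frameVec, Prod.snd_sum, polar_hyperbolicSum, hy, Pi.single_apply]
  have hγ : polarSum (hyperbolicSum q (Fin m → A)) Finset.univ
      (fun i => frameVec A Q m (Sum.inl i)) (fun i => (-y i, (0, 0))) (z, (f, x)) =
        (-adjoint q hq α f, (0, 0)) := by
    rw [adjoint_eq_of_forall q hq α f (∑ i, f (Pi.single i 1) • y i), polarSum_apply]
    · ext1
      · simp [frameVec, Prod.fst_sum, polar_hyperbolicSum]
      · ext1 <;> simp [Prod.snd_sum]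
    · intro z
      rw [dual_apply_eq_sum, ← polarBilin_apply_apply, map_sum, LinearMap.sum_apply]
      simp [hy]
  rw [eichler, hα, hγ, hα]
  change elemMap q hq α (z, (f, x)) = _
  ext1
  · simp [elemMap, sub_eq_add_neg]
  · ext1 <;> simp [elemMap]

theorem elemDual_mem [Module.Projective A Q] {m : ℕ}
    {K : Subgroup (orthogonalGroup (hyperbolicSum q (Fin m → A)))}
    (hK : ∀ k, ∀ y ∈ polarIdeal (hyperbolicSum q (Fin m → A))
        (LinearMap.range (LinearMap.inl A Q _)) •
      LinearMap.ker ((hyperbolicSum q (Fin m → A)).polarBilin (frameVec A Q m k)),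
        SiegelMem K (frameVec A Q m k) y) (β : Q →ₗ[A] Module.Dual A (Fin m → A)) :
    elemDual q hq β ∈ K := by
  let y : Fin m → Q := fun i => (dualEquiv q hq).symm (β.flip (Pi.single i 1))
  have hy : ∀ i z, polar q (y i) z = β z (Pi.single i 1) :=
    fun i z => polar_dualEquiv_symm q hq _ z
  refine mem_of_eichler q hq hK Sum.inr (by simp) (fun i => -y i) ?_
  rintro ⟨z, f, x⟩
  have hβ : ∀ v, polarSum (hyperbolicSum q (Fin m → A)) Finset.univ (fun i => (-y i, (0, 0)))
      (fun i => frameVec A Q m (Sum.inr i)) v = (0, (-β v.1, 0)) := fun v => by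
    rw [polarSum_apply]
    ext1
    · simp [frameVec, Prod.fst_sum]
    · ext1
      · ext i
        simp [frameVec, Prod.fst_sum, Prod.snd_sum, polar_hyperbolicSum, hy, Pi.single_apply]
      · simp [frameVec, Prod.snd_sum]
  have hγ : polarSum (hyperbolicSum q (Fin m → A)) Finset.univ
      (fun i => frameVec A Q m (Sum.inr i)) (fun i => (-y i, (0, 0))) (z, (f, x)) =
        (-adjointDual q hq β x, (0, 0)) := by
    rw [adjointDual_eq_of_forall q hq β x (∑ i, x i • y i), polarSum_apply]
    · ext1
      · simp [frameVec, Prod.fst_sum, polar_hyperbolicSum]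
      · ext1 <;> simp [Prod.snd_sum]
    · intro z
      rw [dual_apply_eq_sum, ← polarBilin_apply_apply, map_sum, LinearMap.sum_apply]
      simp [hy, mul_comm]
  rw [eichler, hβ, hγ, hβ]
  change elemDualMap q hq β (z, (f, x)) = _
  ext1
  · simp [elemDualMap, sub_eq_add_neg]
  · ext1 <;> simp [elemDualMap]

end HyperbolicSum

theorem two_le_of_topologicalKrullDim {A : Type*} [CommRing A] [Nontrivial A] {m : ℕ}
    (hm : topologicalKrullDim (MaximalSpectrum A) + 2 ≤ (m : WithBot ℕ∞)) : 2 ≤ m := by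
  have h : 0 ≤ topologicalKrullDim (MaximalSpectrum A) := by
    have : Nonempty (TopologicalSpace.IrreducibleCloseds (MaximalSpectrum A)) := by
      obtain ⟨x⟩ := (inferInstance : Nonempty (MaximalSpectrum A))
      exact ⟨⟨closure {x}, isIrreducible_singleton.closure, isClosed_closure⟩⟩
    exact Order.krullDim_nonneg
  have h2 : ((2 : ℕ) : WithBot ℕ∞) ≤ (m : WithBot ℕ∞) := by
    refine le_trans ?_ hm
    calc ((2 : ℕ) : WithBot ℕ∞) = 0 + 2 := by simp
      _ ≤ _ := by gcongr
  exact_mod_cast h2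

end RoyOrthogonal

theorem mainTheorem2 {A : Type*} [CommRing A] [Invertible (2 : A)]
    {Q : Type*} [AddCommGroup Q] [Module A Q] [Module.Finite A Q] [Module.Projective A Q]
    (q : QuadraticForm A Q) (hq : RoyOrthogonal.Nonsingular q) (m : ℕ)
    (hm : topologicalKrullDim (MaximalSpectrum A) + 2 ≤ (m : WithBot ℕ∞)) :
    (RoyOrthogonal.elementaryOrthogonalGroup q hq (Fin m → A)).Normal := by
  obtain hA | hA := subsingleton_or_nontrivial A
  -- Over the zero ring the dimension is `⊥`, so `m` may be less than `2`.
  · have hM := Module.subsingleton A (Q × (Module.Dual A (Fin m → A) × (Fin m → A)))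
    refine ⟨fun x hx g => ?_⟩
    have hgx : g * x * g⁻¹ = x := Subtype.ext (LinearEquiv.ext fun v => Subsingleton.elim _ _)
    rwa [hgx]
  · have h2 : 2 ≤ m := RoyOrthogonal.two_le_of_topologicalKrullDim hm
    have hbar : ∀ k : Fin m ⊕ Fin m, ∃ l, l ≠ k ∧ l ≠ Sum.swap k := by
      have : Nontrivial (Fin m) := Fin.nontrivial_iff_two_le.2 h2
      rintro (i | i) <;> obtain ⟨j, hj⟩ := exists_ne i <;> exact ⟨Sum.inl j, by simp [hj]⟩
    have hK := fun k y => (RoyOrthogonal.isHyperbolicFrame q m).siegelMem_normalCore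
      (RoyOrthogonal.siegelMem_frameVec q hq m) hbar k (y := y)
    have hle : RoyOrthogonal.elementaryOrthogonalGroup q hq (Fin m → A) ≤
        (RoyOrthogonal.elementaryOrthogonalGroup q hq (Fin m → A)).normalCore := by
      conv_lhs => rw [RoyOrthogonal.elementaryOrthogonalGroup]
      rw [Subgroup.closure_le]
      rintro _ (⟨α, rfl⟩ | ⟨β, rfl⟩)
      · exact RoyOrthogonal.elem_mem q hq hK α
      · exact RoyOrthogonal.elemDual_mem q hq hK β
    rw [le_antisymm hle (Subgroup.normalCore_le _)]
    infer_instance
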